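/- Let $n\ge 2$ be an integer. Let $\mathbf Z[\frac1n]=\{an^b : a,b\in\mathbf Z\}\subset\mathbf R$, let $\langle n\rangle=\{n^k: k\in\mathbf Z\}$, let $\langle\langle n\rangle\rangle$ be the multiplicative group generated by the prime divisors of $n$, and let $\phi_n:\mathbf Z[\frac1n]\to\mathbf Z_{n-1}=\mathbf Z/(n-1)\mathbf Z$ be the ring homomorphism $an^b\mapsto a \bmod (n-1)$. A homeomorphism $h$ of $\mathbf R$ is PL if it is piecewise linear with a locally finite set of breaks (points where the slope jumps). Let $A_n(\mathbf R)$ be the group of all orientation preserving PL homeomorphisms $h$ of $\mathbf R$ such that all slopes of $h$ lie in $\langle n\rangle$, all breaks of $h$ lie in $\mathbf Z[\frac1n]$, and $h(\mathbf Z[\frac1n])=\mathbf Z[\frac1n]$. Let $B_n(\mathbf R)$ be the kernel of the homomorphism $\rho_n:A_n(\mathbf R)\to\mathbf Z_{n-1}$, $\rho_n(f)=\phi_n(f(x))-\phi_n(x)$ (which is independent of the choice of $x\in\mathbf Z[\frac1n]$). For $G=A_n(\mathbf R)$ or $G=B_n(\mathbf R)$, let $\mathrm{Aut}_{PL}(G)$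 be the group of orientation preserving PL homeomorphisms of $\mathbf R$ that normalize $G$, acting on $G$ by conjugation, and let $\mathrm{Out}_{PL}(G)$ be its image in the outer automorphism group $\mathrm{Out}(G)=\mathrm{Aut}(G)/\mathrm{Inn}(G)$. (a) A PL homeomorphism of $\mathbf R$ (of either orientation) normalizes $A_n(\mathbf R)$ if and only if it normalizes $B_n(\mathbf R)$; in particular $\mathrm{Aut}_{PL}(A_n(\mathbf R))=\mathrm{Aut}_{PL}(B_n(\mathbf R))$. An orientation preserving PL homeomorphism $h$ of $\mathbf R$ belongs to this group if and only if all breaks of $h$ lie in $\mathbf Z[\frac1n]$, $h(\mathbf Z[\frac1n])=\mathbf Z[\frac1n]$, and all slopes of $h$ lie in a single coset belonging to $\langle\langle n\rangle\rangle/\langle n\rangle$. (b) $\mathrm{Out}_{PL}(A_n(\mathbf R))\cong\langle\langle n\rangle\rangle/\langle n\rangle$. (c) $\mathrm{Out}_{PL}(B_n(\mathbf R))\cong\mathbf Z_{n-1}\rtimes\langle\langle n\rangle\rangle/\langle n\rangle$, where the coset of $s\in\langle\langle n\rangle\rangle$ acts on $\mathbf Z_{n-1}$ as multiplication by $\phi_n(s)$.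 -/

import Mathlib

open Filter Topology

noncomputable section

namespace PLR

/-! ### Piecewise linear homeomorphisms of the line -/

/-- `f` is affine with slope `m` on a one-sided neighbourhood `[x, x + ε)` of `x`. -/
def RightAffine (f : ℝ → ℝ) (x m : ℝ) : Prop :=
  ∀ᶠ y in 𝓝[>] x, f y = f x + m * (y - x)

/-- `f` is affine with slope `m` on a one-sided neighbourhood `(x - ε, x]` of `x`. -/
def LeftAffine (f : ℝ → ℝ) (x m : ℝ) : Prop :=
  ∀ᶠ y in 𝓝[<] x, f y = f x + m * (y - x)

/-- `f` is piecewise linear: every point has a neighbourhood on each side of which `f` is affine.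
By compactness this says that `f` is continuous and affine between consecutive points of a
locally finite (closed discrete) subset of `ℝ`. -/
def IsPL (f : ℝ → ℝ) : Prop :=
  ∀ x, (∃ m, LeftAffine f x m) ∧ (∃ m, RightAffine f x m)

/-- The breaks of a piecewise linear function: the points where the slope jumps. -/
def breaks (f : ℝ → ℝ) : Set ℝ := {x | ¬ DifferentiableAt ℝ f x}

/-- The slopes of a piecewise linear function: the values of its derivative. -/
def slopes (f : ℝ → ℝ) : Set ℝ := {m | ∃ x, HasDerivAt f m x}

theorem RightAffine.exists_hasDerivAt {f : ℝ → ℝ} {x m : ℝ} (h : RightAffine f x m) :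
    m ∈ slopes f := by
  obtain ⟨u, hu, hsub⟩ := mem_nhdsGT_iff_exists_Ioo_subset.1 h
  obtain ⟨y, hy⟩ := exists_between (show x < u from hu)
  refine ⟨y, ?_⟩
  have hd : HasDerivAt (fun z => f x + m * (z - x)) m y := by
    simpa using (((hasDerivAt_id y).sub_const x).const_mul m).const_add (f x)
  exact hd.congr_of_eventuallyEq
    (Filter.mem_of_superset (Ioo_mem_nhds hy.1 hy.2) (fun z hz => hsub hz))

theorem RightAffine.eq_of_hasDerivAt {f : ℝ → ℝ} {x m m' : ℝ} (h : RightAffine f x m)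
    (h' : HasDerivAt f m' x) : m' = m := by
  have hd : HasDerivAt (fun z => f x + m * (z - x)) m x := by
    simpa using (((hasDerivAt_id x).sub_const x).const_mul m).const_add (f x)
  have h1 : HasDerivWithinAt f m (Set.Ioi x) x :=
    hd.hasDerivWithinAt.congr_of_eventuallyEq h (by simp)
  exact (uniqueDiffWithinAt_Ioi x).eq_deriv _ h'.hasDerivWithinAt h1

theorem tendsto_nhdsGT {h : ℝ ≃ₜ ℝ} (hm : StrictMono h) (x : ℝ) :
    Tendsto h (𝓝[>] x) (𝓝[>] (h x)) :=
  tendsto_nhdsWithin_of_tendsto_nhds_of_eventually_within _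
    (h.continuous.continuousAt.tendsto.mono_left nhdsWithin_le_nhds)
    (eventually_nhdsWithin_of_forall fun _ hy => hm hy)

theorem tendsto_nhdsLT {h : ℝ ≃ₜ ℝ} (hm : StrictMono h) (x : ℝ) :
    Tendsto h (𝓝[<] x) (𝓝[<] (h x)) :=
  tendsto_nhdsWithin_of_tendsto_nhds_of_eventually_within _
    (h.continuous.continuousAt.tendsto.mono_left nhdsWithin_le_nhds)
    (eventually_nhdsWithin_of_forall fun _ hy => hm hy)

theorem strictMono_inv {h : ℝ ≃ₜ ℝ} (hm : StrictMono h) : StrictMono (h⁻¹ : ℝ ≃ₜ ℝ) := by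
  intro a b hab
  by_contra hcon
  have := hm.monotone (not_lt.1 hcon)
  rw [show h ((h⁻¹ : ℝ ≃ₜ ℝ) b) = b from h.apply_symm_apply b,
    show h ((h⁻¹ : ℝ ≃ₜ ℝ) a) = a from h.apply_symm_apply a] at this
  exact absurd hab (not_lt.2 this)

theorem RightAffine.mul {g f : ℝ ≃ₜ ℝ} (hf : StrictMono f) {x a b : ℝ}
    (h1 : RightAffine f x a) (h2 : RightAffine g (f x) b) :
    RightAffine (g * f : ℝ ≃ₜ ℝ) x (b * a) := by
  filter_upwards [h1, (tendsto_nhdsGT hf x).eventually h2] with y hy1 hy2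
  change g (f y) = g (f x) + _
  rw [hy2, hy1]; ring

theorem LeftAffine.mul {g f : ℝ ≃ₜ ℝ} (hf : StrictMono f) {x a b : ℝ}
    (h1 : LeftAffine f x a) (h2 : LeftAffine g (f x) b) :
    LeftAffine (g * f : ℝ ≃ₜ ℝ) x (b * a) := by
  filter_upwards [h1, (tendsto_nhdsLT hf x).eventually h2] with y hy1 hy2
  change g (f y) = g (f x) + _
  rw [hy2, hy1]; ring

theorem RightAffine.pos {f : ℝ ≃ₜ ℝ} (hf : StrictMono f) {x a : ℝ}
    (h1 : RightAffine f x a) : 0 < a := by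
  obtain ⟨y, hy1, hy2⟩ := (h1.and (eventually_mem_nhdsWithin (a := x) (s := Set.Ioi x))).exists
  have hy2 : x < y := hy2
  have := hf hy2
  by_contra hcon
  nlinarith [mul_nonneg (sub_nonneg.2 hy2.le) (sub_nonneg.2 (not_lt.1 hcon))]

theorem LeftAffine.pos {f : ℝ ≃ₜ ℝ} (hf : StrictMono f) {x a : ℝ}
    (h1 : LeftAffine f x a) : 0 < a := by
  obtain ⟨y, hy1, hy2⟩ := (h1.and (eventually_mem_nhdsWithin (a := x) (s := Set.Iio x))).exists
  have hy2 : y < x := hy2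
  have := hf hy2
  by_contra hcon
  nlinarith [mul_nonneg (sub_nonneg.2 hy2.le) (sub_nonneg.2 (not_lt.1 hcon))]

theorem RightAffine.inv {f : ℝ ≃ₜ ℝ} (hf : StrictMono f) {y a : ℝ}
    (h1 : RightAffine f ((f⁻¹ : ℝ ≃ₜ ℝ) y) a) : RightAffine (f⁻¹ : ℝ ≃ₜ ℝ) y a⁻¹ := by
  have ha := h1.pos hf
  filter_upwards [(tendsto_nhdsGT (strictMono_inv hf) y).eventually h1] with z hz
  rw [show f ((f⁻¹ : ℝ ≃ₜ ℝ) z) = z from f.apply_symm_apply z,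
    show f ((f⁻¹ : ℝ ≃ₜ ℝ) y) = y from f.apply_symm_apply y] at hz
  field_simp
  linarith

theorem LeftAffine.inv {f : ℝ ≃ₜ ℝ} (hf : StrictMono f) {y a : ℝ}
    (h1 : LeftAffine f ((f⁻¹ : ℝ ≃ₜ ℝ) y) a) : LeftAffine (f⁻¹ : ℝ ≃ₜ ℝ) y a⁻¹ := by
  have ha := h1.pos hf
  filter_upwards [(tendsto_nhdsLT (strictMono_inv hf) y).eventually h1] with z hz
  rw [show f ((f⁻¹ : ℝ ≃ₜ ℝ) z) = z from f.apply_symm_apply z,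
    show f ((f⁻¹ : ℝ ≃ₜ ℝ) y) = y from f.apply_symm_apply y] at hz
  field_simp
  linarith

/-- The group `PL₊(ℝ)` of orientation preserving piecewise linear homeomorphisms of `ℝ`. -/
def PLPlus : Subgroup (ℝ ≃ₜ ℝ) where
  carrier := {h | StrictMono h ∧ IsPL h}
  one_mem' := ⟨strictMono_id, fun x =>
    ⟨⟨1, Eventually.of_forall fun y => by simp⟩, ⟨1, Eventually.of_forall fun y => by simp⟩⟩⟩
  mul_mem' := by
    rintro g f ⟨hg, hg'⟩ ⟨hf, hf'⟩
    refine ⟨hg.comp hf, fun x => ?_⟩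
    obtain ⟨⟨a, ha⟩, ⟨b, hb⟩⟩ := hf' x
    obtain ⟨⟨c, hc⟩, ⟨d, hd⟩⟩ := hg' (f x)
    exact ⟨⟨_, ha.mul hf hc⟩, ⟨_, hb.mul hf hd⟩⟩
  inv_mem' := by
    rintro f ⟨hf, hf'⟩
    refine ⟨strictMono_inv hf, fun y => ?_⟩
    obtain ⟨⟨a, ha⟩, ⟨b, hb⟩⟩ := hf' ((f⁻¹ : ℝ ≃ₜ ℝ) y)
    exact ⟨⟨_, ha.inv hf⟩, ⟨_, hb.inv hf⟩⟩

/-! ### The ring `ℤ[1/n]`, the reduction `φ_n`, and the groups `⟨n⟩` and `⟨⟨n⟩⟩` -/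

variable (n : ℕ) [n.AtLeastTwo]

theorem n_ne_zero : (n : ℝ) ≠ 0 := by
  have := Nat.AtLeastTwo.prop (n := n)
  positivity

theorem common_rep {x y : ℝ} (hx : ∃ a b : ℤ, x = a * (n : ℝ) ^ b)
    (hy : ∃ a b : ℤ, y = a * (n : ℝ) ^ b) :
    ∃ a a' b : ℤ, x = a * (n : ℝ) ^ b ∧ y = a' * (n : ℝ) ^ b := by
  have h0 := n_ne_zero n
  obtain ⟨a, b, rfl⟩ := hx
  obtain ⟨a', b', rfl⟩ := hy
  rcases le_total b b' with h | h
  · obtain ⟨k, hk⟩ := Int.eq_ofNat_of_zero_le (sub_nonneg.2 h)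
    refine ⟨a, a' * n ^ k, b, rfl, ?_⟩
    rw [show b' = k + b by omega, zpow_add₀ h0]
    push_cast [zpow_natCast]; ring
  · obtain ⟨k, hk⟩ := Int.eq_ofNat_of_zero_le (sub_nonneg.2 h)
    refine ⟨a * n ^ k, a', b', ?_, rfl⟩
    rw [show b = k + b' by omega, zpow_add₀ h0]
    push_cast [zpow_natCast]; ring

/-- The ring `ℤ[1/n] = {a n ^ b | a, b ∈ ℤ}`, as a subring of `ℝ`. -/
def ZInv : Subring ℝ where
  carrier := {x | ∃ a b : ℤ, x = a * (n : ℝ) ^ b}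
  zero_mem' := ⟨0, 0, by simp⟩
  one_mem' := ⟨1, 0, by simp⟩
  add_mem' := by
    intro x y hx hy
    obtain ⟨a, a', b, rfl, rfl⟩ := common_rep n hx hy
    exact ⟨a + a', b, by push_cast; ring⟩
  neg_mem' := by
    rintro x ⟨a, b, rfl⟩
    exact ⟨-a, b, by push_cast; ring⟩
  mul_mem' := by
    rintro x y ⟨a, b, rfl⟩ ⟨a', b', rfl⟩
    exact ⟨a * a', b + b', by rw [zpow_add₀ (n_ne_zero n)]; push_cast; ring⟩

theorem natCast_eq_one : (n : ZMod (n - 1)) = 1 := by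
  have h : n = (n - 1) + 1 := by have := Nat.AtLeastTwo.prop (n := n); omega
  have h1 : (n : ZMod (n - 1)) = ((n - 1 : ℕ) : ZMod (n - 1)) + 1 := by
    exact_mod_cast congrArg (Nat.cast : ℕ → ZMod (n - 1)) h
  rw [h1, ZMod.natCast_self, zero_add]

theorem residue_unique {a b a' b' : ℤ} (h : (a : ℝ) * (n : ℝ) ^ b = a' * (n : ℝ) ^ b') :
    (a : ZMod (n - 1)) = a' := by
  wlog hle : b ≤ b' generalizing a b a' b'
  · exact (this h.symm (le_of_not_ge hle)).symm
  have h0 := n_ne_zero n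
  obtain ⟨k, hk⟩ := Int.eq_ofNat_of_zero_le (sub_nonneg.2 hle)
  rw [show b' = k + b by omega, zpow_add₀ h0, ← mul_assoc] at h
  have h1 := mul_right_cancel₀ (zpow_ne_zero b h0) h
  have h2 : a = a' * n ^ k := by
    rw [zpow_natCast] at h1
    exact_mod_cast h1
  rw [h2]
  push_cast
  rw [natCast_eq_one]; simp

/-- The value `a mod (n - 1)` of the reduction at `x = a n ^ b`. -/
def phiFun (x : ZInv n) : ZMod (n - 1) := ((x.2.choose : ℤ) : ZMod (n - 1))

theorem phiFun_eq (x : ZInv n) (a b : ℤ) (h : (x : ℝ) = a * (n : ℝ) ^ b) :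
    phiFun n x = (a : ZMod (n - 1)) := by
  obtain ⟨b', hb'⟩ := x.2.choose_spec
  exact residue_unique n (hb'.symm.trans h)

/-- The ring homomorphism `φ_n : ℤ[1/n] → ℤ/(n-1)`, `a n ^ b ↦ a mod (n - 1)`. -/
def phi : ZInv n →+* ZMod (n - 1) where
  toFun := phiFun n
  map_zero' := by simpa using phiFun_eq n 0 0 0 (by simp)
  map_one' := by simpa using phiFun_eq n 1 1 0 (by simp)
  map_add' := by
    intro x y
    obtain ⟨a, a', b, hx, hy⟩ := common_rep n x.2 y.2
    rw [phiFun_eq n x a b hx, phiFun_eq n y a' b hy,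
      phiFun_eq n (x + y) (a + a') b (by push_cast [hx, hy]; ring)]
    push_cast; rfl
  map_mul' := by
    intro x y
    obtain ⟨a, a', b, hx, hy⟩ := common_rep n x.2 y.2
    rw [phiFun_eq n x a b hx, phiFun_eq n y a' b hy,
      phiFun_eq n (x * y) (a * a') (b + b)
        (by rw [zpow_add₀ (n_ne_zero n)]; push_cast [hx, hy]; ring)]
    push_cast; rfl

theorem phi_eq (x : ZInv n) (a b : ℤ) (h : (x : ℝ) = a * (n : ℝ) ^ b) :
    phi n x = (a : ZMod (n - 1)) := phiFun_eq n x a b h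

/-- `n` as a unit of `ℝ`. -/
def nUnit : ℝˣ := Units.mk0 (n : ℝ) (n_ne_zero n)

/-- `⟨n⟩`, the multiplicative cyclic group `{n ^ k | k ∈ ℤ}`. -/
def cyc : Subgroup ℝˣ := Subgroup.zpowers (nUnit n)

/-- `⟨⟨n⟩⟩`, the multiplicative group of (rational) numbers generated by the prime divisors
of `n`. -/
def primeGrp : Subgroup ℝˣ :=
  Subgroup.closure {u | ∃ p : ℕ, p.Prime ∧ p ∣ n ∧ (u : ℝ) = p}

/-- The quotient group `⟨⟨n⟩⟩ / ⟨n⟩`. -/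
abbrev SlopeQuot : Type := primeGrp n ⧸ (cyc n).subgroupOf (primeGrp n)

theorem primeGrp_mem {u : ℝˣ} (hu : u ∈ primeGrp n) :
    (u : ℝ) ∈ ZInv n ∧ ((u⁻¹ : ℝˣ) : ℝ) ∈ ZInv n := by
  induction hu using Subgroup.closure_induction with
  | mem u hu =>
    obtain ⟨p, hp, ⟨q, hq⟩, hpu⟩ := hu
    refine ⟨⟨p, 0, by simp [hpu]⟩, ⟨q, -1, ?_⟩⟩
    have h0 := n_ne_zero n
    have hp0 : (p : ℝ) ≠ 0 := by exact_mod_cast hp.ne_zero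
    have hn : (n : ℝ) = p * q := by exact_mod_cast hq
    have hq0 : (q : ℝ) ≠ 0 := by rintro h; rw [h] at hn; simp at hn; exact h0 (by simp [hn])
    rw [Units.val_inv_eq_inv_val, hpu, zpow_neg_one, hn]
    push_cast
    field_simp
  | one => simp [one_mem]
  | mul u v _ _ hu hv =>
    refine ⟨by simpa using mul_mem hu.1 hv.1, ?_⟩
    rw [mul_inv, Units.val_mul]
    exact mul_mem hu.2 hv.2
  | inv u _ hu => exact ⟨hu.2, by simpa using hu.1⟩

/-- Elements of `⟨⟨n⟩⟩` are units of `ℤ[1/n]`. -/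
def primeGrpToUnits : primeGrp n →* (ZInv n)ˣ where
  toFun u :=
    { val := ⟨((u : ℝˣ) : ℝ), (primeGrp_mem n u.2).1⟩
      inv := ⟨(((u : ℝˣ)⁻¹ : ℝˣ) : ℝ), (primeGrp_mem n u.2).2⟩
      val_inv := by ext; simp
      inv_val := by ext; simp }
  map_one' := by ext; simp
  map_mul' u v := by ext; simp

/-- The restriction of `φ_n` to a homomorphism from `⟨⟨n⟩⟩` to the units of `ℤ/(n-1)`. -/
def phiUnits : primeGrp n →* (ZMod (n - 1))ˣ :=
  (Units.map (phi n : ZInv n →* ZMod (n - 1))).comp (primeGrpToUnits n)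

theorem cyc_le_ker : (cyc n).subgroupOf (primeGrp n) ≤ (phiUnits n).ker := by
  rintro ⟨u, hu⟩ h
  obtain ⟨k, hk⟩ := Subgroup.mem_zpowers_iff.1 (show u ∈ Subgroup.zpowers (nUnit n) from h)
  rw [MonoidHom.mem_ker]
  apply Units.ext
  have hval : ((u : ℝˣ) : ℝ) = ((1 : ℤ) : ℝ) * (n : ℝ) ^ k := by
    rw [← hk]; simp [nUnit]
  exact (phi_eq n ⟨(u : ℝ), (primeGrp_mem n hu).1⟩ 1 k hval).trans Int.cast_one

/-- The homomorphism `⟨⟨n⟩⟩ / ⟨n⟩ → (ℤ/(n-1))ˣ` induced by `φ_n`. -/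
def phiQuot : SlopeQuot n →* (ZMod (n - 1))ˣ :=
  QuotientGroup.lift _ (phiUnits n) (cyc_le_ker n)

/-- The action of `⟨⟨n⟩⟩ / ⟨n⟩` on (the additive group) `ℤ/(n-1)`, by multiplication
through `φ_n`. -/
def slopeAction : SlopeQuot n →* MulAut (Multiplicative (ZMod (n - 1))) :=
  ((MulAutMultiplicative (ZMod (n - 1))).symm.toMonoidHom.comp AddAut.mulLeft).comp (phiQuot n)

/-- The semidirect product `ℤ/(n-1) ⋊ ⟨⟨n⟩⟩ / ⟨n⟩`. -/
abbrev AffQuot : Type := Multiplicative (ZMod (n - 1)) ⋊[slopeAction n] SlopeQuot n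

/-! ### The groups `A_n(ℝ)` and `B_n(ℝ)` -/

/-- `A_n(ℝ)`: the orientation preserving piecewise linear homeomorphisms of `ℝ` with all slopes
in `⟨n⟩` and all breaks in `ℤ[1/n]`, which map `ℤ[1/n]` onto itself.  (The breaks of a piecewise
linear function automatically form a discrete set.) -/
def A : Subgroup (ℝ ≃ₜ ℝ) where
  carrier := {h | StrictMono h ∧ IsPL h ∧ (∀ m ∈ slopes h, ∃ k : ℤ, m = (n : ℝ) ^ k) ∧
    breaks h ⊆ ZInv n ∧ h '' (ZInv n : Set ℝ) = ZInv n}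
  one_mem' := by
    refine ⟨PLPlus.one_mem.1, PLPlus.one_mem.2, ?_, ?_, ?_⟩
    · rintro m ⟨x, hx⟩
      exact ⟨0, by simpa using hx.unique (hasDerivAt_id x)⟩
    · intro x hx
      exact absurd (differentiableAt_id (x := x)) hx
    · exact Set.image_id _
  mul_mem' := by
    rintro g f ⟨hg1, hg2, hg3, hg4, hg5⟩ ⟨hf1, hf2, hf3, hf4, hf5⟩
    have hgf := PLPlus.mul_mem (x := g) (y := f) ⟨hg1, hg2⟩ ⟨hf1, hf2⟩
    refine ⟨hgf.1, hgf.2, ?_, ?_, ?_⟩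
    · rintro m ⟨x, hx⟩
      obtain ⟨a, ha⟩ := (hf2 x).2
      obtain ⟨b, hb⟩ := (hg2 (f x)).2
      obtain ⟨k, hk⟩ := hf3 a ha.exists_hasDerivAt
      obtain ⟨l, hl⟩ := hg3 b hb.exists_hasDerivAt
      exact ⟨l + k, by rw [(ha.mul hf1 hb).eq_of_hasDerivAt hx, zpow_add₀ (n_ne_zero n), hk, hl]⟩
    · intro x hx
      by_contra hxn
      have hfx : DifferentiableAt ℝ f x := by
        by_contra hcon
        exact hxn (hf4 hcon)
      have hgx : DifferentiableAt ℝ g (f x) := by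
        by_contra hcon
        have h1 := hg4 hcon
        rw [← hf5] at h1
        obtain ⟨z, hz, hzx⟩ := h1
        exact hxn (f.injective hzx ▸ hz)
      exact hx (hgx.comp x hfx)
    · change (fun x => g (f x)) '' _ = _
      rw [← Set.image_image (fun y => g y) (fun x => f x), hf5, hg5]
  inv_mem' := by
    rintro f ⟨hf1, hf2, hf3, hf4, hf5⟩
    have hfi := PLPlus.inv_mem (x := f) ⟨hf1, hf2⟩
    have hpre : ∀ x, f x ∈ (ZInv n : Set ℝ) → x ∈ (ZInv n : Set ℝ) := by
      intro x hx
      rw [← hf5] at hx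
      obtain ⟨z, hz, hzx⟩ := hx
      exact f.injective hzx ▸ hz
    have hinv : ∀ y, f ((f⁻¹ : ℝ ≃ₜ ℝ) y) = y := fun y => f.apply_symm_apply y
    refine ⟨hfi.1, hfi.2, ?_, ?_, ?_⟩
    · rintro m ⟨y, hy⟩
      obtain ⟨a, ha⟩ := (hf2 ((f⁻¹ : ℝ ≃ₜ ℝ) y)).2
      obtain ⟨k, hk⟩ := hf3 a ha.exists_hasDerivAt
      exact ⟨-k, by rw [(ha.inv hf1).eq_of_hasDerivAt hy, zpow_neg, hk]⟩
    · intro y hy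
      by_contra hyn
      have hd : DifferentiableAt ℝ f ((f⁻¹ : ℝ ≃ₜ ℝ) y) := by
        by_contra hcon
        apply hyn
        rw [← hf5]
        exact ⟨_, hf4 hcon, hinv y⟩
      obtain ⟨a, ha⟩ := (hf2 ((f⁻¹ : ℝ ≃ₜ ℝ) y)).2
      have h1 := ha.eq_of_hasDerivAt hd.hasDerivAt
      have h2 : HasDerivAt f a ((f⁻¹ : ℝ ≃ₜ ℝ) y) := h1 ▸ hd.hasDerivAt
      exact hy (h2.of_local_left_inverse (f⁻¹ : ℝ ≃ₜ ℝ).continuous.continuousAt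
        (ha.pos hf1).ne' (Eventually.of_forall hinv)).differentiableAt
    · ext y
      constructor
      · rintro ⟨z, hz, rfl⟩
        exact hpre _ (by rw [hinv]; exact hz)
      · intro hy
        refine ⟨f y, ?_, f.symm_apply_apply y⟩
        rw [← hf5]
        exact ⟨y, hy, rfl⟩

variable {n}

theorem A_map_mem (f : A n) {x : ℝ} (hx : x ∈ ZInv n) : (f : ℝ ≃ₜ ℝ) x ∈ ZInv n := by
  have h : (f : ℝ ≃ₜ ℝ) x ∈ (ZInv n : Set ℝ) := by
    rw [← f.2.2.2.2.2]
    exact ⟨x, hx, rfl⟩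
  exact h

/-- The map of `ℤ[1/n]` to itself induced by an element of `A_n(ℝ)`. -/
def A.act (f : A n) (x : ZInv n) : ZInv n := ⟨(f : ℝ ≃ₜ ℝ) x, A_map_mem f x.2⟩

theorem phi_pow_mul (k : ℤ) {x y : ZInv n} (h : (y : ℝ) = (n : ℝ) ^ k * x) :
    phi n y = phi n x := by
  obtain ⟨a, b, hx⟩ := x.2
  rw [phi_eq n x a b hx, phi_eq n y a (k + b)]
  rw [h, hx, zpow_add₀ (n_ne_zero n)]; ring

theorem dense_ZInv : Dense (ZInv n : Set ℝ) := by
  have h2 : (1 : ℝ) < n := by exact_mod_cast Nat.AtLeastTwo.prop (n := n)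
  refine AddSubgroup.dense_of_not_isolated_zero (ZInv n).toAddSubgroup fun ε hε => ?_
  obtain ⟨k, hk⟩ := exists_pow_lt_of_lt_one hε (inv_lt_one_of_one_lt₀ h2)
  refine ⟨((n : ℝ)⁻¹) ^ k, ?_, ?_, hk⟩
  · exact ⟨1, -k, by simp⟩
  · positivity

theorem LeftAffine.mem_slopes {f : ℝ → ℝ} {x m : ℝ} (h : LeftAffine f x m) :
    m ∈ slopes f := by
  obtain ⟨u, hu, hsub⟩ := mem_nhdsLT_iff_exists_Ioo_subset.1 h
  obtain ⟨y, hy⟩ := exists_between (show u < x from hu)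
  refine ⟨y, ?_⟩
  have hd : HasDerivAt (fun z => f x + m * (z - x)) m y := by
    simpa using (((hasDerivAt_id y).sub_const x).const_mul m).const_add (f x)
  exact hd.congr_of_eventuallyEq
    (Filter.mem_of_superset (Ioo_mem_nhds hy.1 hy.2) (fun z hz => hsub hz))

/-- The residue shift is constant near any point of the line. -/
theorem shift_local (f : A n) (x : ℝ) : ∃ c : ZMod (n - 1), ∀ᶠ y in 𝓝 x,
    ∀ z : ZInv n, (z : ℝ) = y → phi n (A.act f z) - phi n z = c := by
  obtain ⟨hf1, hf2, hf3, hf4, -⟩ := f.2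
  obtain ⟨⟨a, ha⟩, ⟨b, hb⟩⟩ := hf2 x
  obtain ⟨k, rfl⟩ := hf3 a ha.mem_slopes
  obtain ⟨l, rfl⟩ := hf3 b hb.exists_hasDerivAt
  have hboth : ∀ᶠ y in 𝓝 x, (y < x → (f : ℝ ≃ₜ ℝ) y = (f : ℝ ≃ₜ ℝ) x + (n : ℝ) ^ k * (y - x)) ∧
      (x < y → (f : ℝ ≃ₜ ℝ) y = (f : ℝ ≃ₜ ℝ) x + (n : ℝ) ^ l * (y - x)) :=
    (eventually_nhdsWithin_iff.1 ha).and (eventually_nhdsWithin_iff.1 hb)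
  by_cases hx : x ∈ ZInv n
  · refine ⟨phi n (A.act f ⟨x, hx⟩) - phi n ⟨x, hx⟩, ?_⟩
    filter_upwards [hboth] with y hy z hz
    rw [sub_eq_sub_iff_sub_eq_sub, ← map_sub, ← map_sub]
    rcases lt_trichotomy y x with h | h | h
    · refine phi_pow_mul k ?_
      simp [A.act, hz, hy.1 h]
    · have : z = ⟨x, hx⟩ := Subtype.ext (hz.trans h)
      simp [this]
    · refine phi_pow_mul l ?_
      simp [A.act, hz, hy.2 h]
  · have hd : DifferentiableAt ℝ (f : ℝ ≃ₜ ℝ) x := by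
      by_contra hcon
      exact hx (hf4 hcon)
    have hkl : (n : ℝ) ^ k = (n : ℝ) ^ l := by
      have h1 := hb.eq_of_hasDerivAt hd.hasDerivAt
      have hda : HasDerivAt (fun z => (f : ℝ ≃ₜ ℝ) x + (n : ℝ) ^ k * (z - x)) ((n : ℝ) ^ k) x := by
        simpa using (((hasDerivAt_id x).sub_const x).const_mul ((n : ℝ) ^ k)).const_add
          ((f : ℝ ≃ₜ ℝ) x)
      have h2 : HasDerivWithinAt (f : ℝ ≃ₜ ℝ) ((n : ℝ) ^ k) (Set.Iio x) x :=
        hda.hasDerivWithinAt.congr_of_eventuallyEq ha (by simp)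
      have h3 := (uniqueDiffWithinAt_Iio x).eq_deriv _ h2 hd.hasDerivAt.hasDerivWithinAt
      exact h3.trans h1
    obtain ⟨ε, hε, hball⟩ := Metric.eventually_nhds_iff_ball.1 hboth
    obtain ⟨w, hw, hwball⟩ := dense_ZInv (n := n).exists_mem_open Metric.isOpen_ball
      ⟨x, Metric.mem_ball_self hε⟩
    have hall : ∀ y ∈ Metric.ball x ε,
        (f : ℝ ≃ₜ ℝ) y = (f : ℝ ≃ₜ ℝ) x + (n : ℝ) ^ l * (y - x) := by
      intro y hy
      rcases lt_trichotomy y x with h | h | h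
      · rw [(hball y hy).1 h, hkl]
      · simp [h]
      · exact (hball y hy).2 h
    refine ⟨phi n (A.act f ⟨w, hw⟩) - phi n ⟨w, hw⟩, ?_⟩
    filter_upwards [Metric.ball_mem_nhds x hε] with y hy z hz
    rw [sub_eq_sub_iff_sub_eq_sub, ← map_sub, ← map_sub]
    refine phi_pow_mul l ?_
    simp only [A.act, AddSubgroupClass.coe_sub, hz]
    rw [hall y hy, hall w hwball]; ring

/-- The residue shift does not depend on the point of `ℤ[1/n]`. -/
theorem shift_eq (f : A n) (x y : ZInv n) :
    phi n (A.act f x) - phi n x = phi n (A.act f y) - phi n y := by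
  choose F hF using shift_local f
  have hloc : IsLocallyConstant F := by
    rw [IsLocallyConstant.iff_eventually_eq]
    intro u
    filter_upwards [(hF u).eventually_nhds] with v hv
    obtain ⟨s, hs, hso, hvs⟩ := eventually_nhds_iff.1 (hv.and (hF v))
    obtain ⟨w, hw, hws⟩ := dense_ZInv (n := n).exists_mem_open hso ⟨v, hvs⟩
    rw [← (hs w hws).1 ⟨w, hw⟩ rfl, ← (hs w hws).2 ⟨w, hw⟩ rfl]
  rw [(hF x).self_of_nhds x rfl, (hF y).self_of_nhds y rfl]
  exact hloc.apply_eq_of_preconnectedSpace _ _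

variable (n)

/-- The homomorphism `ρ_n : A_n(ℝ) → ℤ/(n-1)`, `f ↦ φ_n(f(x)) - φ_n(x)` for some (by `shift_eq`,
equivalently for every) `x ∈ ℤ[1/n]`. -/
def rho : A n →* Multiplicative (ZMod (n - 1)) where
  toFun f := Multiplicative.ofAdd (phi n (A.act f 0) - phi n 0)
  map_one' := by
    rw [show A.act (1 : A n) 0 = 0 from rfl, sub_self]; rfl
  map_mul' g f := by
    rw [← ofAdd_add, ← shift_eq g (A.act f 0) 0]
    congr 1
    rw [sub_add_sub_cancel]; rfl

/-- `B_n(ℝ)`, the kernel of `ρ_n`. -/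
def B : Subgroup (ℝ ≃ₜ ℝ) := (rho n).ker.map (A n).subtype

/-! ### Piecewise linear automorphisms -/

/-- The (orientation preserving) piecewise linear normalizers of a group `G` of homeomorphisms of
the line. -/
def AutPL (G : Subgroup (ℝ ≃ₜ ℝ)) : Subgroup (ℝ ≃ₜ ℝ) :=
  Subgroup.normalizer (G : Set (ℝ ≃ₜ ℝ)) ⊓ PLPlus

/-- The group of inner automorphisms. -/
def Inn (G : Type*) [Group G] : Subgroup (MulAut G) := (MulAut.conj : G →* MulAut G).range

instance Inn.normal (G : Type*) [Group G] : (Inn G).Normal where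
  conj_mem := by
    rintro _ ⟨g, rfl⟩ α
    refine ⟨α g, ?_⟩
    ext x
    simp [MulAut.conj_apply, MulAut.mul_apply]

/-- The outer automorphism group. -/
abbrev Out (G : Type*) [Group G] : Type _ := MulAut G ⧸ Inn G

/-- The action of the normalizer of `G` on `G` by conjugation, read in `Out(G)`. -/
def normalizerToOut (G : Subgroup (ℝ ≃ₜ ℝ)) :
    Subgroup.normalizer (G : Set (ℝ ≃ₜ ℝ)) →* Out G :=
  (QuotientGroup.mk' (Inn G)).comp G.normalizerMonoidHom

/-- `Out_PL(G)`: the image in `Out(G)` of the piecewise linear normalizers of `G`. -/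
def OutPL (G : Subgroup (ℝ ≃ₜ ℝ)) : Subgroup (Out G) :=
  ((AutPL G).subgroupOf (Subgroup.normalizer (G : Set (ℝ ≃ₜ ℝ)))).map (normalizerToOut G)

end PLR

end

open PLR

namespace PLR

/-! ### Outer automorphisms induced by normalizers -/

/-! Both normalizers equal one group, `cosetGroup n`: the PL homeomorphisms with breaks in ℤ[1/n],
preserving ℤ[1/n], and with all slopes in one coset of ⟨n⟩ in ⟨⟨n⟩⟩.

Each such map normalizes A and B, because both are kernels of homomorphisms on `cosetGroup n`. The
slope coset (`slopeCoset`) has kernel A. On residues mod n-1 a map with slope coset c acts affinely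
with multiplier φ_n(c) (`HasSlopeCoset.phi_act_sub`), and recording this affine action together with
c (`residueAction`) has kernel B. Both homomorphisms are surjective, as the maps x ↦ s x + d show.

Conversely, if h and its inverse conjugate B into A, two families of elements of B test h
(`exists_hasSlopeCoset_of_conj`). A kink with its only break at x conjugates to a map with a break
at h(x), so h preserves ℤ[1/n]. Translations by (n-1)d are dense among all translations; conjugating
them compares slopes of h at different points, forces the ratios to be powers of n, and excludes
breaks outside ℤ[1/n].

Kinks also show that B has trivial centralizer (`eq_one_of_commute_B`), so a normalizer acts as an
inner automorphism only if it lies in the group. Hence Out_PL is the normalizer modulo the group,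
which the two homomorphisms compute (`nonempty_outPL_mulEquiv`). Orientation reversing maps reduce
to the preserving case by composing with x ↦ -x. -/

theorem le_normalizer_of_ker {G H : Subgroup (ℝ ≃ₜ ℝ)} {Q : Type*} [Group Q] (hGH : G ≤ H)
    (π : H →* Q) (hker : ∀ h : H, π h = 1 ↔ (h : ℝ ≃ₜ ℝ) ∈ G) :
    H ≤ Subgroup.normalizer (G : Set (ℝ ≃ₜ ℝ)) := by
  have key : ∀ h ∈ H, ∀ g ∈ G, h * g * h⁻¹ ∈ G := by
    intro h hh g hg
    have h1 : π (⟨h, hh⟩ * ⟨g, hGH hg⟩ * ⟨h, hh⟩⁻¹) = 1 := by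
      rw [map_mul, map_mul, (hker ⟨g, hGH hg⟩).2 hg, mul_one, map_inv, mul_inv_cancel]
    exact (hker _).1 h1
  intro h hh
  rw [Subgroup.mem_normalizer_iff]
  refine fun g => ⟨key h hh g, fun hg => ?_⟩
  have := key h⁻¹ (inv_mem hh) _ hg
  simpa [mul_assoc] using this

/-- If h in the normalizer acts on G as some g ∈ G does, then g⁻¹h centralizes G, so h = g. The map
to Out(G) thus has kernel G, the same as π, and the first isomorphism theorem applies to both. -/
theorem nonempty_outPL_mulEquiv {G H : Subgroup (ℝ ≃ₜ ℝ)} {Q : Type*} [Group Q]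
    (hH : AutPL G = H) (hcent : ∀ c : ℝ ≃ₜ ℝ, (∀ g ∈ G, c * g = g * c) → c = 1)
    (π : H →* Q) (hπ : Function.Surjective π)
    (hker : ∀ h : H, π h = 1 ↔ (h : ℝ ≃ₜ ℝ) ∈ G) : Nonempty (OutPL G ≃* Q) := by
  subst hH
  let ψ : AutPL G →* Out G := (normalizerToOut G).comp
    (Subgroup.inclusion (inf_le_left : AutPL G ≤ Subgroup.normalizer (G : Set (ℝ ≃ₜ ℝ))))
  have hrange : ψ.range = OutPL G := by
    ext x
    constructor
    · rintro ⟨h, rfl⟩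
      exact ⟨_, h.2, rfl⟩
    · rintro ⟨h, hh, rfl⟩
      exact ⟨⟨h, hh⟩, rfl⟩
  have hkereq : ψ.ker = π.ker := by
    ext h
    rw [MonoidHom.mem_ker, MonoidHom.mem_ker, hker]
    have h1 : ψ h = 1 ↔ G.normalizerMonoidHom ⟨h, h.2.1⟩ ∈ Inn G := QuotientGroup.eq_one_iff _
    rw [h1]
    constructor
    · rintro ⟨g, hg⟩
      -- Equal conjugation actions make g⁻¹h commute with every element of G.
      have h2 : (g : ℝ ≃ₜ ℝ)⁻¹ * h = 1 := by
        refine hcent _ fun f hf => ?_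
        have h3 := congrArg Subtype.val (DFunLike.congr_fun hg ⟨f, hf⟩)
        have h4 : (g : ℝ ≃ₜ ℝ) * f * (g : ℝ ≃ₜ ℝ)⁻¹ = h * f * (h : ℝ ≃ₜ ℝ)⁻¹ := h3
        have h5 : (h : ℝ ≃ₜ ℝ) * f = g * f * (g : ℝ ≃ₜ ℝ)⁻¹ * h := by
          rw [h4]; group
        rw [mul_assoc, h5]; group
      rw [← inv_mul_eq_one.1 h2]
      exact g.2
    · intro hg
      exact ⟨⟨h, hg⟩, by ext f; rfl⟩
  exact ⟨(MulEquiv.subgroupCongr hrange.symm).trans <|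
    (QuotientGroup.quotientKerEquivRange ψ).symm.trans <|
    (QuotientGroup.quotientMulEquivOfEq hkereq).trans <|
    QuotientGroup.quotientKerEquivOfSurjective π hπ⟩

/-! ### One-sided slopes -/

theorem hasDerivAt_affine (c m a x : ℝ) : HasDerivAt (fun z => c + m * (z - a)) m x := by
  simpa using (((hasDerivAt_id x).sub_const a).const_mul m).const_add c

theorem LeftAffine.eq_of_hasDerivAt {f : ℝ → ℝ} {x m m' : ℝ} (h : LeftAffine f x m)
    (h' : HasDerivAt f m' x) : m' = m := by
  have h1 : HasDerivWithinAt f m (Set.Iio x) x :=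
    (hasDerivAt_affine (f x) m x x).hasDerivWithinAt.congr_of_eventuallyEq h (by simp)
  exact (uniqueDiffWithinAt_Iio x).eq_deriv _ h'.hasDerivWithinAt h1

theorem hasDerivAt_of_leftAffine_rightAffine {f : ℝ → ℝ} {x m : ℝ} (hl : LeftAffine f x m)
    (hr : RightAffine f x m) : HasDerivAt f m x := by
  have h1 : ∀ᶠ y in 𝓝 x, f y = f x + m * (y - x) := by
    filter_upwards [eventually_nhdsWithin_iff.1 hl, eventually_nhdsWithin_iff.1 hr] with y h1 h2
    rcases lt_trichotomy y x with h | h | h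
    · exact h1 h
    · simp [h]
    · exact h2 h
  exact (hasDerivAt_affine (f x) m x x).congr_of_eventuallyEq h1

theorem mem_breaks_iff {f : ℝ → ℝ} {x a b : ℝ} (hl : LeftAffine f x a) (hr : RightAffine f x b) :
    x ∈ breaks f ↔ a ≠ b := by
  constructor
  · rintro hx rfl
    exact hx (hasDerivAt_of_leftAffine_rightAffine hl hr).differentiableAt
  · intro hab hd
    exact hab ((hl.eq_of_hasDerivAt hd.hasDerivAt).symm.trans (hr.eq_of_hasDerivAt hd.hasDerivAt))

/-- A function which is affine to the right of `x` is affine, with the same slope, near all points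
just to the right of `x`. -/
theorem RightAffine.eventually_affine {f : ℝ → ℝ} {x m : ℝ} (h : RightAffine f x m) :
    ∀ᶠ y in 𝓝[>] x, LeftAffine f y m ∧ RightAffine f y m := by
  obtain ⟨u, hu, hsub⟩ := mem_nhdsGT_iff_exists_Ioo_subset.1 h
  filter_upwards [Ioo_mem_nhdsGT (show x < u from hu)] with y hy
  have h1 : ∀ᶠ z in 𝓝 y, f z = f y + m * (z - y) := by
    filter_upwards [Ioo_mem_nhds hy.1 hy.2] with z hz
    have h2 : f z = f x + m * (z - x) := hsub hz
    have h3 : f y = f x + m * (y - x) := hsub hy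
    rw [h2, h3]; ring
  exact ⟨h1.filter_mono nhdsWithin_le_nhds, h1.filter_mono nhdsWithin_le_nhds⟩

theorem rightAffine_of_affine {f : ℝ → ℝ} {m c : ℝ} (hf : ∀ y, f y = m * y + c) (x : ℝ) :
    RightAffine f x m :=
  Eventually.of_forall fun y => by rw [hf, hf]; ring

theorem leftAffine_of_affine {f : ℝ → ℝ} {m c : ℝ} (hf : ∀ y, f y = m * y + c) (x : ℝ) :
    LeftAffine f x m :=
  Eventually.of_forall fun y => by rw [hf, hf]; ring

/-! ### Units of `ℤ[1/n]` -/

theorem mem_primeGrp_of_natCast (n a : ℕ) (ha : a ≠ 0) (hp : ∀ p : ℕ, p.Prime → p ∣ a → p ∣ n)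
    (u : ℝˣ) (hu : (u : ℝ) = a) : u ∈ primeGrp n := by
  induction a using induction_on_primes generalizing u with
  | zero => exact absurd rfl ha
  | one =>
    rw [show u = 1 from Units.ext (by simpa using hu)]
    exact one_mem _
  | prime_mul p a hpp ih =>
    have ha0 : a ≠ 0 := right_ne_zero_of_mul ha
    have hp0 : (p : ℝ) ≠ 0 := by exact_mod_cast hpp.ne_zero
    have ha0' : (a : ℝ) ≠ 0 := by exact_mod_cast ha0
    rw [show u = Units.mk0 (p : ℝ) hp0 * Units.mk0 (a : ℝ) ha0' from
      Units.ext (by simpa using hu)]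
    refine mul_mem (Subgroup.subset_closure ⟨p, hpp, hp p hpp (dvd_mul_right _ _), rfl⟩) ?_
    exact ih ha0 (fun q hq hqa => hp q hq (hqa.mul_left p)) _ rfl

theorem primeGrp_pos {n : ℕ} (s : primeGrp n) : 0 < ((s : ℝˣ) : ℝ) := by
  obtain ⟨u, hu⟩ := s
  change 0 < (u : ℝ)
  induction hu using Subgroup.closure_induction with
  | mem u hu =>
    obtain ⟨p, hp, -, hpu⟩ := hu
    rw [hpu]; exact_mod_cast hp.pos
  | one => simp
  | mul u v _ _ hu hv => simpa using mul_pos hu hv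
  | inv u _ hu => simpa using hu

/-! ### Affine test maps and units of ℤ[1/n] -/

/-- The affine map `x ↦ s x + d` with `s ∈ ⟨⟨n⟩⟩`. -/
noncomputable def affineMap {n : ℕ} (s : primeGrp n) (d : ℝ) : ℝ ≃ₜ ℝ :=
  affineHomeomorph ((s : ℝˣ) : ℝ) d (s : ℝˣ).ne_zero

theorem affineMap_apply {n : ℕ} (s : primeGrp n) (d x : ℝ) :
    affineMap s d x = ((s : ℝˣ) : ℝ) * x + d := rfl

/-- The translation by `(n - 1) d`. -/
noncomputable def residueTranslation (n : ℕ) (d : ℝ) : ℝ ≃ₜ ℝ :=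
  Homeomorph.addRight (((n - 1 : ℕ) : ℝ) * d)

theorem residueTranslation_apply (n : ℕ) (d x : ℝ) :
    residueTranslation n d x = 1 * x + ((n - 1 : ℕ) : ℝ) * d := by
  rw [one_mul]; rfl

variable (n : ℕ) [n.AtLeastTwo]

theorem one_lt_cast : (1 : ℝ) < n := by
  exact_mod_cast Nat.AtLeastTwo.prop (n := n)

theorem cyc_le_primeGrp : cyc n ≤ primeGrp n := by
  rw [cyc, Subgroup.zpowers_le]
  exact mem_primeGrp_of_natCast n n (by have := Nat.AtLeastTwo.prop (n := n); omega)
    (fun _ _ h => h) _ rfl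

/-- With m = a n^b and m⁻¹ = a' n^b', the identity a a' n^(b+b') = 1 makes a divide a power of n, so
every prime factor of a divides n. -/
theorem exists_primeGrp_of_unit {m : ℝ} (hm : 0 < m) (h1 : m ∈ ZInv n) (h2 : m⁻¹ ∈ ZInv n) :
    ∃ s : primeGrp n, ((s : ℝˣ) : ℝ) = m := by
  have h0 := n_ne_zero n
  have hpos : (0 : ℝ) < n := one_pos.trans (one_lt_cast n)
  obtain ⟨a, b, hab⟩ := h1
  obtain ⟨a', b', hab'⟩ := h2
  have ha : (0 : ℝ) < a := by
    by_contra hcon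
    exact absurd hm (not_lt.2 (hab ▸ mul_nonpos_of_nonpos_of_nonneg (not_lt.1 hcon)
      (zpow_pos hpos b).le))
  obtain ⟨a, rfl⟩ := Int.eq_ofNat_of_zero_le (show 0 ≤ a by exact_mod_cast ha.le)
  have hprod : (a : ℝ) * a' * (n : ℝ) ^ (b + b') = 1 := by
    have : m * m⁻¹ = 1 := mul_inv_cancel₀ hm.ne'
    rw [hab', hab] at this
    rw [zpow_add₀ h0, ← this]; push_cast; ring
  have ha0 : a ≠ 0 := by rintro rfl; simp at ha
  -- For b + b' ≥ 0 the integer a already divides 1, hence the witness k = 0; otherwise k = -(b +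
  -- b').
  have hdiv : ∃ k : ℕ, (a : ℤ) ∣ (n : ℤ) ^ k := by
    rcases le_total 0 (b + b') with h | h
    · obtain ⟨k, hk⟩ := Int.eq_ofNat_of_zero_le h
      rw [hk, zpow_natCast] at hprod
      refine ⟨0, a' * n ^ k, ?_⟩
      rw [pow_zero, ← mul_assoc]
      exact_mod_cast hprod.symm
    · obtain ⟨k, hk⟩ := Int.eq_ofNat_of_zero_le (neg_nonneg.2 h)
      rw [show b + b' = -k by omega, zpow_neg, zpow_natCast,
        mul_inv_eq_one₀ (pow_ne_zero k h0)] at hprod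
      exact ⟨k, a', by exact_mod_cast hprod.symm⟩
  obtain ⟨k, hk⟩ := hdiv
  have hk : a ∣ n ^ k := by exact_mod_cast hk
  have ha0' : (a : ℝ) ≠ 0 := by exact_mod_cast ha0
  have hmem := mem_primeGrp_of_natCast n a ha0
    (fun p hp hpa => hp.dvd_of_dvd_pow (hpa.trans hk)) (Units.mk0 (a : ℝ) ha0') rfl
  refine ⟨⟨_, mul_mem hmem (zpow_mem (cyc_le_primeGrp n (Subgroup.mem_zpowers _)) b)⟩, ?_⟩
  simp [hab, nUnit]

/-! ### Cosets of slopes -/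

variable {n}

/-- The real number `m` belongs to the coset `c` of `⟨n⟩` in `⟨⟨n⟩⟩`. -/
def InCoset (c : SlopeQuot n) (m : ℝ) : Prop :=
  ∃ s : primeGrp n, ((s : ℝˣ) : ℝ) = m ∧ (QuotientGroup.mk s : SlopeQuot n) = c

theorem InCoset.mul {c d : SlopeQuot n} {a b : ℝ} (ha : InCoset c a) (hb : InCoset d b) :
    InCoset (c * d) (a * b) := by
  obtain ⟨s, rfl, rfl⟩ := ha
  obtain ⟨t, rfl, rfl⟩ := hb
  exact ⟨s * t, by simp, rfl⟩

theorem InCoset.inv {c : SlopeQuot n} {a : ℝ} (ha : InCoset c a) : InCoset c⁻¹ a⁻¹ := by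
  obtain ⟨s, rfl, rfl⟩ := ha
  exact ⟨s⁻¹, by simp, rfl⟩

theorem InCoset.unique {c d : SlopeQuot n} {a : ℝ} (hc : InCoset c a) (hd : InCoset d a) :
    c = d := by
  obtain ⟨s, rfl, rfl⟩ := hc
  obtain ⟨t, ht, rfl⟩ := hd
  rw [Subtype.ext (Units.ext ht)]

theorem inCoset_one_iff {a : ℝ} : InCoset (1 : SlopeQuot n) a ↔ ∃ k : ℤ, a = (n : ℝ) ^ k := by
  constructor
  · rintro ⟨s, rfl, hs⟩
    obtain ⟨k, hk⟩ := Subgroup.mem_zpowers_iff.1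
      (show (s : ℝˣ) ∈ Subgroup.zpowers (nUnit n) from (QuotientGroup.eq_one_iff s).1 hs)
    exact ⟨k, by rw [← hk]; simp [nUnit]⟩
  · rintro ⟨k, rfl⟩
    have hk : nUnit n ^ k ∈ cyc n := zpow_mem (Subgroup.mem_zpowers _) k
    exact ⟨⟨_, cyc_le_primeGrp n hk⟩, by simp [nUnit], (QuotientGroup.eq_one_iff _).2 hk⟩

theorem InCoset.of_div {c : SlopeQuot n} {a b : ℝ} {k : ℤ} (ha : InCoset c a)
    (hk : b = a * (n : ℝ) ^ k) : InCoset c b := by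
  rw [hk, ← mul_one c]
  exact ha.mul (inCoset_one_iff.2 ⟨k, rfl⟩)


/-! ### Homeomorphisms with all slopes in a single coset -/

/-- `h` is an orientation preserving piecewise linear homeomorphism of `ℝ` which preserves
`ℤ[1/n]`, has all its breaks there, and has all its slopes in the coset `c`. -/
structure HasSlopeCoset (h : ℝ ≃ₜ ℝ) (c : SlopeQuot n) : Prop where
  strictMono : StrictMono h
  isPL : IsPL h
  inCoset : ∀ m ∈ slopes h, InCoset c m
  breaks_subset : breaks h ⊆ ZInv n
  image_eq : h '' (ZInv n : Set ℝ) = ZInv n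

theorem mem_iff_of_image_eq {h : ℝ ≃ₜ ℝ} {s : Set ℝ} (hs : h '' s = s) {x : ℝ} :
    h x ∈ s ↔ x ∈ s := by
  conv_lhs => rw [← hs]
  exact h.injective.mem_set_image

theorem image_eq_of_mem_iff {h : ℝ ≃ₜ ℝ} {s : Set ℝ} (hs : ∀ x, h x ∈ s ↔ x ∈ s) :
    h '' s = s := by
  ext y
  obtain ⟨x, rfl⟩ := h.surjective y
  rw [hs]
  exact h.injective.mem_set_image

theorem apply_inv_self' (h : ℝ ≃ₜ ℝ) (y : ℝ) : h ((h⁻¹ : ℝ ≃ₜ ℝ) y) = y := h.apply_symm_apply y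

theorem inv_apply_self' (h : ℝ ≃ₜ ℝ) (y : ℝ) : (h⁻¹ : ℝ ≃ₜ ℝ) (h y) = y := h.symm_apply_apply y

theorem mul_apply' (g h : ℝ ≃ₜ ℝ) (y : ℝ) : (g * h : ℝ ≃ₜ ℝ) y = g (h y) := rfl

namespace HasSlopeCoset

variable {g h : ℝ ≃ₜ ℝ} {c d : SlopeQuot n}

theorem apply_mem_iff (hh : HasSlopeCoset h c) {x : ℝ} : h x ∈ ZInv n ↔ x ∈ ZInv n :=
  mem_iff_of_image_eq hh.image_eq

theorem exists_affine (hh : HasSlopeCoset h c) (x : ℝ) :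
    ∃ a b, LeftAffine h x a ∧ RightAffine h x b ∧ InCoset c a ∧ InCoset c b ∧
      (x ∉ ZInv n → a = b) := by
  obtain ⟨⟨a, ha⟩, b, hb⟩ := hh.isPL x
  refine ⟨a, b, ha, hb, hh.inCoset a ha.mem_slopes, hh.inCoset b hb.exists_hasDerivAt, fun hx => ?_⟩
  by_contra hab
  exact hx (hh.breaks_subset ((mem_breaks_iff ha hb).2 hab))

/-- Any derivative equals the right slope, so only right slopes need to lie in the coset; left
slopes serve only to exclude breaks outside ℤ[1/n]. -/
theorem of_exists_affine (hmono : StrictMono h) (hmem : ∀ x, h x ∈ ZInv n ↔ x ∈ ZInv n)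
    (H : ∀ x, ∃ a b, LeftAffine h x a ∧ RightAffine h x b ∧ InCoset c b ∧
      (x ∉ ZInv n → a = b)) : HasSlopeCoset h c where
  strictMono := hmono
  isPL x := by
    obtain ⟨a, b, ha, hb, -⟩ := H x
    exact ⟨⟨a, ha⟩, b, hb⟩
  inCoset := by
    rintro m ⟨x, hx⟩
    obtain ⟨a, b, ha, hb, hc, -⟩ := H x
    rwa [hb.eq_of_hasDerivAt hx]
  breaks_subset x hx := by
    obtain ⟨a, b, ha, hb, -, hab⟩ := H x
    by_contra hcon
    exact (mem_breaks_iff ha hb).1 hx (hab hcon)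
  image_eq := image_eq_of_mem_iff hmem

theorem mul (hg : HasSlopeCoset g c) (hh : HasSlopeCoset h d) :
    HasSlopeCoset (g * h : ℝ ≃ₜ ℝ) (c * d) := by
  refine of_exists_affine (hg.strictMono.comp hh.strictMono)
    (fun x => hg.apply_mem_iff.trans hh.apply_mem_iff) fun x => ?_
  obtain ⟨a, b, ha, hb, -, hdb, hab⟩ := hh.exists_affine x
  obtain ⟨a', b', ha', hb', -, hcb, hab'⟩ := hg.exists_affine (h x)
  refine ⟨_, _, ha.mul hh.strictMono ha', hb.mul hh.strictMono hb', hcb.mul hdb, fun hx => ?_⟩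
  rw [hab hx, hab' (fun hcon => hx (hh.apply_mem_iff.1 hcon))]

theorem inv (hh : HasSlopeCoset h c) : HasSlopeCoset (h⁻¹ : ℝ ≃ₜ ℝ) c⁻¹ := by
  have hmem : ∀ x, (h⁻¹ : ℝ ≃ₜ ℝ) x ∈ ZInv n ↔ x ∈ ZInv n := fun x => by
    rw [← hh.apply_mem_iff, apply_inv_self']
  refine of_exists_affine (strictMono_inv hh.strictMono) hmem fun x => ?_
  obtain ⟨a, b, ha, hb, -, hcb, hab⟩ := hh.exists_affine ((h⁻¹ : ℝ ≃ₜ ℝ) x)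
  refine ⟨_, _, ha.inv hh.strictMono, hb.inv hh.strictMono, hcb.inv, fun hx => ?_⟩
  rw [hab (fun hcon => hx ((hmem x).1 hcon))]

/-- Every PL homeomorphism has some slope, here the right slope at 0, and a number lies in at most
one coset. -/
theorem unique (hc : HasSlopeCoset h c) (hd : HasSlopeCoset h d) : c = d := by
  obtain ⟨-, b, -, hb, -, hcb, -⟩ := hc.exists_affine 0
  exact hcb.unique (hd.inCoset b hb.exists_hasDerivAt)

end HasSlopeCoset

theorem hasSlopeCoset_one_iff {h : ℝ ≃ₜ ℝ} : HasSlopeCoset h (1 : SlopeQuot n) ↔ h ∈ A n := by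
  constructor
  · intro hh
    exact ⟨hh.strictMono, hh.isPL, fun m hm => inCoset_one_iff.1 (hh.inCoset m hm),
      hh.breaks_subset, hh.image_eq⟩
  · rintro ⟨h1, h2, h3, h4, h5⟩
    exact ⟨h1, h2, fun m hm => inCoset_one_iff.2 (h3 m hm), h4, h5⟩

theorem hasSlopeCoset_affineMap (s : primeGrp n) {d : ℝ} (hd : d ∈ ZInv n) :
    HasSlopeCoset (affineMap s d) (QuotientGroup.mk s : SlopeQuot n) := by
  refine .of_exists_affine (fun x y hxy => ?_) (fun x => ?_) fun x =>
    ⟨_, _, leftAffine_of_affine (affineMap_apply s d) x,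
      rightAffine_of_affine (affineMap_apply s d) x, ⟨s, rfl, rfl⟩, fun _ => rfl⟩
  · rw [affineMap_apply, affineMap_apply]
    have := mul_lt_mul_of_pos_left hxy (primeGrp_pos s)
    linarith
  · rw [affineMap_apply, add_mem_cancel_right hd]
    refine ⟨fun hx => ?_, fun hx => mul_mem (primeGrp_mem n s.2).1 hx⟩
    have := mul_mem (primeGrp_mem n s.2).2 hx
    rwa [Units.inv_mul_cancel_left] at this

/-! ### Action on residues -/

/-- The map of `ℤ[1/n]` to itself induced by a homeomorphism preserving `ℤ[1/n]`. -/
def HasSlopeCoset.act {h : ℝ ≃ₜ ℝ} {c : SlopeQuot n} (hh : HasSlopeCoset h c) (x : ZInv n) :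
    ZInv n :=
  ⟨h x, hh.apply_mem_iff.2 x.2⟩

/-- A homeomorphism with slopes in the coset `c` acts on residues affinely, with slope `φ_n(c)`. -/
theorem HasSlopeCoset.phi_act_sub {h : ℝ ≃ₜ ℝ} {c : SlopeQuot n} (hh : HasSlopeCoset h c)
    (x y : ZInv n) : phi n (hh.act x) - phi n (hh.act y) =
      (phiQuot n c : ZMod (n - 1)) * (phi n x - phi n y) := by
  obtain ⟨s, rfl⟩ := QuotientGroup.mk_surjective c
  have hs := hasSlopeCoset_affineMap s⁻¹ (zero_mem (ZInv n))
  -- Dividing by a representative s of the coset lands in A, where the residue shift is constant;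
  -- multiplying back by s contributes the factor φ_n(s).
  have hf : affineMap s⁻¹ 0 * h ∈ A n := by
    rw [← hasSlopeCoset_one_iff]
    simpa using hs.mul hh
  have key : ∀ z : ZInv n, phi n (hh.act z) =
      (phiQuot n (QuotientGroup.mk s) : ZMod (n - 1)) * phi n (A.act ⟨_, hf⟩ z) := by
    intro z
    change _ = phi n ⟨((s : ℝˣ) : ℝ), (primeGrp_mem n s.2).1⟩ * _
    rw [← map_mul]
    congr 1
    ext
    change h z = ((s : ℝˣ) : ℝ) * (affineMap s⁻¹ 0 (h z))
    simp [affineMap_apply]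
  have := shift_eq ⟨_, hf⟩ x y
  rw [key, key, ← mul_sub]
  congr 1
  rwa [sub_eq_sub_iff_sub_eq_sub] at this

/-! ### The group of single-coset maps and its two quotients -/

variable (n)

/-- The group of the homeomorphisms with all slopes in a single coset of `⟨n⟩` in `⟨⟨n⟩⟩`. -/
def cosetGroup : Subgroup (ℝ ≃ₜ ℝ) where
  carrier := {h | ∃ c : SlopeQuot n, HasSlopeCoset h c}
  one_mem' := ⟨1, hasSlopeCoset_one_iff.2 (one_mem _)⟩
  mul_mem' := by
    rintro g h ⟨c, hc⟩ ⟨d, hd⟩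
    exact ⟨_, hc.mul hd⟩
  inv_mem' := by
    rintro h ⟨c, hc⟩
    exact ⟨_, hc.inv⟩

theorem A_le_cosetGroup : A n ≤ cosetGroup n := fun _ hh => ⟨1, hasSlopeCoset_one_iff.2 hh⟩

/-- The coset of `⟨n⟩` to which all slopes belong. -/
noncomputable def slopeCoset : cosetGroup n →* SlopeQuot n where
  toFun h := h.2.choose
  map_one' := HasSlopeCoset.unique (Exists.choose_spec (1 : cosetGroup n).2)
    (hasSlopeCoset_one_iff.2 (one_mem _))
  map_mul' g h := HasSlopeCoset.unique (Exists.choose_spec (g * h).2)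
    ((Exists.choose_spec g.2).mul (Exists.choose_spec h.2))

variable {n}

theorem hasSlopeCoset_slopeCoset (h : cosetGroup n) :
    HasSlopeCoset (h : ℝ ≃ₜ ℝ) (slopeCoset n h) :=
  h.2.choose_spec

theorem slopeCoset_eq {h : cosetGroup n} {c : SlopeQuot n} (hc : HasSlopeCoset (h : ℝ ≃ₜ ℝ) c) :
    slopeCoset n h = c :=
  (hasSlopeCoset_slopeCoset h).unique hc

theorem slopeCoset_eq_one_iff (h : cosetGroup n) :
    slopeCoset n h = 1 ↔ (h : ℝ ≃ₜ ℝ) ∈ A n := by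
  rw [← hasSlopeCoset_one_iff]
  exact ⟨fun hh => hh ▸ hasSlopeCoset_slopeCoset h, slopeCoset_eq⟩

theorem slopeCoset_surjective : Function.Surjective (slopeCoset n) := by
  intro c
  obtain ⟨s, rfl⟩ := QuotientGroup.mk_surjective c
  have := hasSlopeCoset_affineMap s (zero_mem (ZInv n))
  exact ⟨⟨_, _, this⟩, slopeCoset_eq this⟩

/-- The residue shift is the same at every point, so membership may be tested wherever it is
easiest: at the break of a kink, or at 0. -/
theorem mem_B_iff {f : ℝ ≃ₜ ℝ} (hf : f ∈ A n) {x : ZInv n} :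
    f ∈ B n ↔ phi n (A.act ⟨f, hf⟩ x) = phi n x := by
  have h1 : f ∈ B n ↔ rho n ⟨f, hf⟩ = 1 := by
    constructor
    · rintro ⟨g, hg, rfl⟩
      exact hg
    · exact fun h => ⟨⟨f, hf⟩, h, rfl⟩
  rw [h1, ← sub_eq_zero (b := phi n x), shift_eq _ x 0]
  exact ofAdd_eq_one

theorem B_le_A : B n ≤ A n := by
  rintro _ ⟨g, -, rfl⟩
  exact g.2

variable (n)

/-- The action of a homeomorphism on residues, with its slopes: an affine map of `ℤ/(n-1)`. -/
noncomputable def residueAction : cosetGroup n →* AffQuot n where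
  toFun h := ⟨.ofAdd (phi n ((hasSlopeCoset_slopeCoset h).act 0)), slopeCoset n h⟩
  map_one' := by
    ext1
    · change Multiplicative.ofAdd (phi n 0) = 1
      rw [map_zero]; rfl
    · exact map_one _
  map_mul' g h := by
    ext1
    · rw [SemidirectProduct.mul_left]
      change _ = Multiplicative.ofAdd (_ + (phiQuot n (slopeCoset n g) : ZMod (n - 1)) * _)
      -- Comparing g at h(0) and at 0 gives φ(g(h(0))) = φ(g(0)) + φ(c)φ(h(0)), with c the slope
      -- coset of g: the semidirect product law.
      have := (hasSlopeCoset_slopeCoset g).phi_act_sub ((hasSlopeCoset_slopeCoset h).act 0) 0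
      rw [map_zero (phi n), sub_zero, sub_eq_iff_eq_add'] at this
      exact this
    · exact map_mul _ _ _

variable {n}

theorem residueAction_eq_one_iff (h : cosetGroup n) :
    residueAction n h = 1 ↔ (h : ℝ ≃ₜ ℝ) ∈ B n := by
  rw [SemidirectProduct.ext_iff]
  change Multiplicative.ofAdd _ = 1 ∧ slopeCoset n h = 1 ↔ _
  rw [slopeCoset_eq_one_iff, ofAdd_eq_one]
  constructor
  · rintro ⟨h1, h2⟩
    rw [mem_B_iff h2 (x := 0), map_zero (phi n)]
    exact h1
  · intro hh
    refine ⟨?_, B_le_A hh⟩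
    rw [mem_B_iff (B_le_A hh) (x := 0), map_zero (phi n)] at hh
    exact hh

theorem residueAction_surjective : Function.Surjective (residueAction n) := by
  rintro ⟨r, c⟩
  obtain ⟨s, rfl⟩ := QuotientGroup.mk_surjective c
  obtain ⟨d, hd⟩ := ZMod.intCast_surjective r.toAdd
  have hd' : (d : ℝ) ∈ ZInv n := intCast_mem _ d
  have := hasSlopeCoset_affineMap s hd'
  refine ⟨⟨_, _, this⟩, ?_⟩
  ext1
  · change Multiplicative.ofAdd _ = r
    rw [← ofAdd_toAdd r, ← hd]
    congr 1
    refine phi_eq n _ d 0 ?_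
    change affineMap s d 0 = _
    simp [affineMap_apply]
  · exact slopeCoset_eq this


/-! ### Test elements of B: kinks and translations -/

theorem natCast_zpow_mem (k : ℤ) : (n : ℝ) ^ k ∈ ZInv n := ⟨1, k, by simp⟩

theorem mul_natCast_mem_iff {x : ℝ} : (n : ℝ) * x ∈ ZInv n ↔ x ∈ ZInv n := by
  refine ⟨fun h => ?_, fun h => mul_mem (natCast_mem _ n) h⟩
  have := mul_mem (natCast_zpow_mem (n := n) (-1)) h
  rwa [zpow_neg_one, inv_mul_cancel_left₀ (n_ne_zero n)] at this

variable (n)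

/-- The homeomorphism which is the identity to the left of `x` and has slope `n` to the right. -/
noncomputable def kink (x : ℝ) : ℝ ≃ₜ ℝ where
  -- As n > 1, the maximum selects the identity left of x and the steeper line right of it; the
  -- inverse is a minimum for the same reason.
  toFun y := max y (x + n * (y - x))
  invFun z := min z (x + (n : ℝ)⁻¹ * (z - x))
  left_inv y := by
    change min (max y (x + n * (y - x))) (x + (n : ℝ)⁻¹ * (max y (x + n * (y - x)) - x)) = y
    have h1 := one_lt_cast n
    have h0 : (0 : ℝ) < n := by linarith
    rcases le_total y x with h | h
    · rw [max_eq_left (by nlinarith), min_eq_left]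
      rw [inv_mul_eq_div, ← sub_le_iff_le_add', le_div_iff₀ h0]
      nlinarith
    · rw [max_eq_right (by nlinarith), min_eq_right]
      · field_simp; ring
      · rw [add_sub_cancel_left, inv_mul_cancel_left₀ h0.ne']
        nlinarith
  right_inv z := by
    change max (min z (x + (n : ℝ)⁻¹ * (z - x)))
      (x + n * (min z (x + (n : ℝ)⁻¹ * (z - x)) - x)) = z
    have h1 := one_lt_cast n
    have h0 : (0 : ℝ) < n := by linarith
    rcases le_total z x with h | h
    · rw [min_eq_left, max_eq_left (by nlinarith)]
      rw [inv_mul_eq_div, ← sub_le_iff_le_add', le_div_iff₀ h0]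
      nlinarith
    · have h2 : x ≤ x + (n : ℝ)⁻¹ * (z - x) :=
        le_add_of_nonneg_right (mul_nonneg (inv_nonneg.2 h0.le) (sub_nonneg.2 h))
      have h3 : x + n * (x + (n : ℝ)⁻¹ * (z - x) - x) = z := by field_simp; ring
      have h4 : x + (n : ℝ)⁻¹ * (z - x) ≤ z := by
        nlinarith
      rw [min_eq_right h4, h3, max_eq_right h4]
  continuous_toFun := by fun_prop
  continuous_invFun := by fun_prop

variable {n}

theorem kink_of_le {x y : ℝ} (h : y ≤ x) : kink n x y = y :=
  max_eq_left (by nlinarith [one_lt_cast n])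

theorem kink_of_ge {x y : ℝ} (h : x ≤ y) : kink n x y = x + n * (y - x) :=
  max_eq_right (by nlinarith [one_lt_cast n])

theorem leftAffine_kink {x y : ℝ} (h : y ≤ x) : LeftAffine (kink n x) y 1 := by
  filter_upwards [self_mem_nhdsWithin] with z hz
  rw [kink_of_le h, kink_of_le ((le_of_lt hz).trans h)]; ring

theorem rightAffine_kink {x y : ℝ} (h : x ≤ y) : RightAffine (kink n x) y n := by
  filter_upwards [self_mem_nhdsWithin] with z hz
  rw [kink_of_ge h, kink_of_ge (h.trans (le_of_lt hz))]; ring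

theorem kink_mem_A {x : ℝ} (hx : x ∈ ZInv n) : kink n x ∈ A n := by
  rw [← hasSlopeCoset_one_iff]
  have h1 := one_lt_cast n
  have hn : InCoset (1 : SlopeQuot n) (n : ℝ) := inCoset_one_iff.2 ⟨1, by simp⟩
  refine .of_exists_affine (fun y z hyz => max_lt_max hyz ?_) (fun y => ?_) fun y => ?_
  · nlinarith
  · rcases le_total y x with h | h
    · rw [kink_of_le h]
    · rw [kink_of_ge h, add_mem_cancel_left hx, mul_natCast_mem_iff, sub_mem_comm_iff,
        ← neg_mem_iff, neg_sub, sub_eq_add_neg, add_mem_cancel_right (neg_mem hx)]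
  · rcases lt_trichotomy y x with h | rfl | h
    · refine ⟨1, 1, leftAffine_kink h.le, ?_, inCoset_one_iff.2 ⟨0, by simp⟩, fun _ => rfl⟩
      filter_upwards [Ioo_mem_nhdsGT h] with z hz
      rw [kink_of_le h.le, kink_of_le hz.2.le]; ring
    · exact ⟨1, n, leftAffine_kink le_rfl, rightAffine_kink le_rfl, hn, fun hy => absurd hx hy⟩
    · refine ⟨n, n, ?_, rightAffine_kink h.le, hn, fun _ => rfl⟩
      filter_upwards [Ioo_mem_nhdsLT h] with z hz
      rw [kink_of_ge h.le, kink_of_ge hz.1.le]; ring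

theorem kink_mem_B {x : ℝ} (hx : x ∈ ZInv n) : kink n x ∈ B n := by
  rw [mem_B_iff (kink_mem_A hx) (x := ⟨x, hx⟩)]
  congr 1
  exact Subtype.ext (kink_of_le le_rfl)

theorem kink_apply_eq_self_iff {x y : ℝ} : kink n x y = y ↔ y ≤ x := by
  refine ⟨fun h => ?_, kink_of_le⟩
  by_contra! hcon
  rw [kink_of_ge hcon.le] at h
  nlinarith [one_lt_cast n]

/-- The centralizer of `B_n(ℝ)` in the homeomorphisms of the line is trivial. -/
theorem eq_one_of_commute_B {c : ℝ ≃ₜ ℝ} (hc : ∀ g ∈ B n, c * g = g * c) : c = 1 := by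
  -- The fixed set of the kink at x is (-∞, x], and a homeomorphism commuting with the kink
  -- preserves that set. Density of ℤ[1/n] then forces c(y) = y.
  have key : ∀ x ∈ ZInv n, ∀ y, c y ≤ x ↔ y ≤ x := by
    intro x hx y
    rw [← kink_apply_eq_self_iff (n := n), ← kink_apply_eq_self_iff (n := n), ← mul_apply',
      ← hc _ (kink_mem_B hx), mul_apply', c.injective.eq_iff]
  ext y
  change c y = y
  rcases lt_trichotomy (c y) y with h | h | h
  · obtain ⟨x, hx, h1, h2⟩ := dense_ZInv (n := n).exists_between h
    exact absurd ((key x hx y).1 h1.le) (not_le.2 h2)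
  · exact h
  · obtain ⟨x, hx, h1, h2⟩ := dense_ZInv (n := n).exists_between h
    exact absurd ((key x hx y).2 h1.le) (not_le.2 h2)

/-- The factor n - 1 vanishes under φ_n, so the translation does not move residues. -/
theorem residueTranslation_mem_B {d : ℝ} (hd : d ∈ ZInv n) : residueTranslation n d ∈ B n := by
  have hmem : ((n - 1 : ℕ) : ℝ) * d ∈ ZInv n := mul_mem (natCast_mem _ _) hd
  have hA : residueTranslation n d ∈ A n := by
    rw [← hasSlopeCoset_one_iff]
    have := hasSlopeCoset_affineMap (1 : primeGrp n) hmem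
    convert this using 1
    · ext x
      rw [residueTranslation_apply]; rfl
    · rfl
  rw [mem_B_iff hA (x := 0), map_zero (phi n)]
  have h2 : A.act ⟨_, hA⟩ 0 = ((n - 1 : ℕ) : ZInv n) * ⟨d, hd⟩ := by
    ext
    change residueTranslation n d 0 = _
    rw [residueTranslation_apply]
    simp
  rw [h2, map_mul, map_natCast, ZMod.natCast_self, zero_mul]

theorem dense_residueTranslation (x : ℝ) :
    Dense ((fun d => residueTranslation n d x) '' (ZInv n : Set ℝ)) := by
  have h0 : ((n - 1 : ℕ) : ℝ) ≠ 0 := by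
    have := Nat.AtLeastTwo.prop (n := n)
    exact_mod_cast (by omega : n - 1 ≠ 0)
  refine DenseRange.dense_image (Function.Surjective.denseRange fun y => ?_) ?_ dense_ZInv
  · refine ⟨(((n - 1 : ℕ) : ℝ))⁻¹ * (y - x), ?_⟩
    rw [residueTranslation_apply, mul_inv_cancel_left₀ h0]; ring
  · simp only [residueTranslation_apply]
    fun_prop

/-! ### Piecewise linear normalizers -/

section Conjugation

variable {h : ℝ ≃ₜ ℝ}

theorem leftAffine_conj (hm : StrictMono h) {f : ℝ ≃ₜ ℝ} (hf : StrictMono f) {x a b c : ℝ}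
    (h1 : LeftAffine h x a) (h2 : LeftAffine f x b) (h3 : LeftAffine h (f x) c) :
    LeftAffine (h * f * h⁻¹ : ℝ ≃ₜ ℝ) (h x) (c * b * a⁻¹) := by
  rw [← inv_apply_self' h x] at h1 h2 h3
  exact (h1.inv hm).mul (strictMono_inv hm) (h2.mul hf h3)

theorem rightAffine_conj (hm : StrictMono h) {f : ℝ ≃ₜ ℝ} (hf : StrictMono f) {x a b c : ℝ}
    (h1 : RightAffine h x a) (h2 : RightAffine f x b) (h3 : RightAffine h (f x) c) :
    RightAffine (h * f * h⁻¹ : ℝ ≃ₜ ℝ) (h x) (c * b * a⁻¹) := by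
  rw [← inv_apply_self' h x] at h1 h2 h3
  exact (h1.inv hm).mul (strictMono_inv hm) (h2.mul hf h3)

/-- The kink at x fixes x, so the slopes of h cancel in the conjugate, which has one-sided slopes 1
and n at h(x). That is a break of an element of A, hence a point of ℤ[1/n]. -/
theorem apply_mem_of_conj (hm : StrictMono h) (hpl : IsPL h)
    (hc : ∀ f ∈ B n, h * f * h⁻¹ ∈ A n) {x : ℝ} (hx : x ∈ ZInv n) : h x ∈ ZInv n := by
  obtain ⟨⟨a, ha⟩, b, hb⟩ := hpl x
  have hk := kink_mem_A hx
  have hfix : kink n x x = x := kink_of_le le_rfl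
  refine (hc _ (kink_mem_B hx)).2.2.2.1 ?_
  refine (mem_breaks_iff (leftAffine_conj hm hk.1 ha (leftAffine_kink le_rfl)
    (by rwa [hfix])) (rightAffine_conj hm hk.1 hb (rightAffine_kink le_rfl)
    (by rwa [hfix]))).2 ?_
  have h1 := one_lt_cast n
  rw [mul_one, mul_inv_cancel₀ (ha.pos hm).ne', mul_right_comm, mul_inv_cancel₀ (hb.pos hm).ne',
    one_mul]
  exact h1.ne

theorem apply_mem_iff_of_conj (hm : StrictMono h) (hpl : IsPL h)
    (hc : ∀ f ∈ B n, h * f * h⁻¹ ∈ A n) (hc' : ∀ f ∈ B n, h⁻¹ * f * h ∈ A n) {x : ℝ} :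
    h x ∈ ZInv n ↔ x ∈ ZInv n := by
  refine ⟨fun hx => ?_, apply_mem_of_conj hm hpl hc⟩
  have hi : h⁻¹ ∈ PLPlus := PLPlus.inv_mem ⟨hm, hpl⟩
  have := apply_mem_of_conj (h := h⁻¹) hi.1 hi.2 (by simpa using hc') hx
  rwa [inv_apply_self'] at this

/-- On an affine piece, two points of ℤ[1/n] at distance n^(-k) have images differing by m n^(-k);
multiplication by n^k recovers m. -/
theorem slope_mem_of_apply_mem (hmem : ∀ x ∈ ZInv n, h x ∈ ZInv n) {x m : ℝ}
    (hr : RightAffine h x m) : m ∈ ZInv n := by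
  obtain ⟨u, hu, hsub⟩ := mem_nhdsGT_iff_exists_Ioo_subset.1 hr
  obtain ⟨d, hd, hxd, hdu⟩ := dense_ZInv (n := n).exists_between (show x < u from hu)
  obtain ⟨k, hk⟩ := exists_pow_lt_of_lt_one (sub_pos.2 hdu)
    (inv_lt_one_of_one_lt₀ (one_lt_cast n))
  have hpos : (0 : ℝ) < n := one_pos.trans (one_lt_cast n)
  have hp : (0 : ℝ) < (n : ℝ)⁻¹ ^ k := by positivity
  have hkmem : (n : ℝ)⁻¹ ^ k ∈ ZInv n := by
    simpa using natCast_zpow_mem (n := n) (-k)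
  have h1 : h d = h x + m * (d - x) := hsub ⟨hxd, hdu⟩
  have h2 : h (d + (n : ℝ)⁻¹ ^ k) = h x + m * (d + (n : ℝ)⁻¹ ^ k - x) :=
    hsub ⟨by linarith, by linarith⟩
  have h3 := mul_mem (sub_mem (hmem _ (add_mem hd hkmem)) (hmem _ hd))
    (natCast_zpow_mem (n := n) k)
  rw [h1, h2] at h3
  convert h3 using 1
  have h4 : (n : ℝ)⁻¹ ^ k * (n : ℝ) ^ (k : ℤ) = 1 := by
    rw [zpow_natCast, ← mul_pow, inv_mul_cancel₀ hpos.ne', one_pow]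
  linear_combination (-m) * h4

theorem exists_hasSlopeCoset_of_conj (hm : StrictMono h) (hpl : IsPL h)
    (hc : ∀ f ∈ B n, h * f * h⁻¹ ∈ A n) (hc' : ∀ f ∈ B n, h⁻¹ * f * h ∈ A n) :
    ∃ c : SlopeQuot n, HasSlopeCoset h c := by
  have hmem : ∀ x, h x ∈ ZInv n ↔ x ∈ ZInv n := fun x => apply_mem_iff_of_conj hm hpl hc hc'
  have hT : ∀ d, StrictMono (residueTranslation n d) := fun d x y hxy => by
    rw [residueTranslation_apply, residueTranslation_apply]; linarith
  obtain ⟨-, a, ha⟩ := hpl 0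
  have hmem' : ∀ x ∈ ZInv n, (h⁻¹ : ℝ ≃ₜ ℝ) x ∈ ZInv n := fun x hx => by
    rwa [← hmem, apply_inv_self']
  -- The slope at 0 and its inverse, a slope of h⁻¹, both lie in ℤ[1/n]; this fixes the coset.
  obtain ⟨s, hs⟩ := exists_primeGrp_of_unit n (ha.pos hm)
    (slope_mem_of_apply_mem (fun x => (hmem x).2) ha) (by
      rw [← inv_apply_self' h 0] at ha
      exact slope_mem_of_apply_mem hmem' (ha.inv hm))
  refine ⟨QuotientGroup.mk s, .of_exists_affine hm hmem fun x => ?_⟩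
  obtain ⟨⟨b, hb⟩, b', hb'⟩ := hpl x
  refine ⟨b, b', hb, hb', ?_, fun hx => ?_⟩
  -- The translates of 0 need not include x, but some lie just right of it, where h still has slope
  -- b'. Conjugating that translation gives right slope b'/a at h(0), which must be a power of n.
  · obtain ⟨u, hu, hsub⟩ := mem_nhdsGT_iff_exists_Ioo_subset.1 hb'.eventually_affine
    obtain ⟨_, ⟨d, hd, rfl⟩, hy⟩ := (dense_residueTranslation (n := n) 0).exists_between
      (show x < u from hu)
    have h1 := rightAffine_conj hm (hT d) ha
      (rightAffine_of_affine (residueTranslation_apply n d) 0) (hsub hy).2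
    obtain ⟨k, hk⟩ := (hc _ (residueTranslation_mem_B hd)).2.2.1 _ h1.exists_hasDerivAt
    refine InCoset.of_div (a := a) (k := k) ⟨s, hs, rfl⟩ ?_
    rw [← hk, mul_one, mul_comm, inv_mul_cancel_right₀ (ha.pos hm).ne']
  · by_contra hbb
    -- Now x itself is moved to a nearby point where h is affine with slope b'. The conjugate has
    -- slopes b'/b and 1 at h(x), so b ≠ b' would give an element of A a break outside ℤ[1/n].
    obtain ⟨u, hu, hsub⟩ := mem_nhdsGT_iff_exists_Ioo_subset.1 hb'.eventually_affine
    obtain ⟨_, ⟨d, hd, rfl⟩, hy⟩ := (dense_residueTranslation (n := n) x).exists_between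
      (show x < u from hu)
    have h1 := leftAffine_conj hm (hT d) hb
      (leftAffine_of_affine (residueTranslation_apply n d) x) (hsub hy).1
    have h2 := rightAffine_conj hm (hT d) hb'
      (rightAffine_of_affine (residueTranslation_apply n d) x) (hsub hy).2
    refine hx ((hmem x).1 ((hc _ (residueTranslation_mem_B hd)).2.2.2.1 ?_))
    refine (mem_breaks_iff h1 h2).2 fun heq => hbb ?_
    rw [mul_one] at heq
    exact inv_injective (mul_left_cancel₀ (hb'.pos hm).ne' heq)

end Conjugation

/-- The converse direction only needs B to be conjugated into A, so one argument serves every G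
between B and A. -/
theorem autPL_eq_cosetGroup {G : Subgroup (ℝ ≃ₜ ℝ)} (hBG : B n ≤ G) (hGA : G ≤ A n)
    (hG : cosetGroup n ≤ Subgroup.normalizer (G : Set (ℝ ≃ₜ ℝ))) : AutPL G = cosetGroup n := by
  refine le_antisymm ?_ fun h hh => ⟨hG hh, ?_⟩
  · rintro h ⟨hn, hm, hpl⟩
    refine exists_hasSlopeCoset_of_conj hm hpl
      (fun f hf => hGA ((Subgroup.mem_normalizer_iff.1 hn f).1 (hBG hf)))
      (fun f hf => hGA ?_)
    have := (Subgroup.mem_normalizer_iff.1 (inv_mem hn) f).1 (hBG hf)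
    rwa [inv_inv] at this
  · obtain ⟨c, hc⟩ := hh
    exact ⟨hc.strictMono, hc.isPL⟩

theorem autPL_A : AutPL (A n) = cosetGroup n :=
  autPL_eq_cosetGroup B_le_A le_rfl
    (le_normalizer_of_ker (A_le_cosetGroup n) (slopeCoset n) slopeCoset_eq_one_iff)

theorem autPL_B : AutPL (B n) = cosetGroup n :=
  autPL_eq_cosetGroup le_rfl B_le_A
    (le_normalizer_of_ker (B_le_A.trans (A_le_cosetGroup n)) (residueAction n)
      residueAction_eq_one_iff)

/-! ### Orientation reversing normalizers -/

theorem neg_mul_self : Homeomorph.neg ℝ * Homeomorph.neg ℝ = 1 := by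
  ext x
  exact neg_neg x

theorem neg_inv_eq : (Homeomorph.neg ℝ)⁻¹ = Homeomorph.neg ℝ :=
  inv_eq_of_mul_eq_one_left neg_mul_self

theorem RightAffine.comp_neg {f : ℝ → ℝ} {x a : ℝ} (h : RightAffine f (-x) a) :
    LeftAffine (fun y => f (-y)) x (-a) := by
  filter_upwards [tendsto_neg_nhdsLT.eventually h] with y hy
  rw [hy]; ring

theorem LeftAffine.comp_neg {f : ℝ → ℝ} {x a : ℝ} (h : LeftAffine f (-x) a) :
    RightAffine (fun y => f (-y)) x (-a) := by
  filter_upwards [tendsto_neg_nhdsGT.eventually h] with y hy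
  rw [hy]; ring

theorem RightAffine.neg {f : ℝ → ℝ} {x a : ℝ} (h : RightAffine f x a) :
    RightAffine (fun y => -f y) x (-a) := by
  filter_upwards [h] with y hy
  rw [hy]; ring

theorem LeftAffine.neg {f : ℝ → ℝ} {x a : ℝ} (h : LeftAffine f x a) :
    LeftAffine (fun y => -f y) x (-a) := by
  filter_upwards [h] with y hy
  rw [hy]; ring

theorem conj_neg_mem_A {f : ℝ ≃ₜ ℝ} (hf : f ∈ A n) :
    Homeomorph.neg ℝ * f * Homeomorph.neg ℝ ∈ A n := by
  rw [← hasSlopeCoset_one_iff] at hf ⊢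
  refine .of_exists_affine (fun x y hxy => neg_lt_neg (hf.strictMono (neg_lt_neg hxy)))
    (fun x => ?_) fun x => ?_
  · change -(f (-x)) ∈ _ ↔ _
    rw [neg_mem_iff, hf.apply_mem_iff, neg_mem_iff]
  · obtain ⟨a, b, ha, hb, hca, -, hab⟩ := hf.exists_affine (-x)
    refine ⟨_, _, hb.comp_neg.neg, ha.comp_neg.neg, by rwa [neg_neg], fun hx => ?_⟩
    rw [hab (fun hcon => hx (neg_mem_iff.1 hcon))]

theorem conj_neg_mem_B {f : ℝ ≃ₜ ℝ} (hf : f ∈ B n) :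
    Homeomorph.neg ℝ * f * Homeomorph.neg ℝ ∈ B n := by
  have hA := B_le_A hf
  rw [mem_B_iff hA (x := 0), map_zero (phi n)] at hf
  rw [mem_B_iff (conj_neg_mem_A hA) (x := 0), map_zero (phi n), ← neg_eq_zero,
    ← map_neg (phi n), ← hf]
  congr 1
  ext
  change - -(f (-0)) = f 0
  rw [neg_zero, neg_neg]

/-- Negation is an involution, so the one inclusion assumed already gives equality. -/
theorem neg_mem_normalizer {G : Subgroup (ℝ ≃ₜ ℝ)}
    (hG : ∀ f ∈ G, Homeomorph.neg ℝ * f * Homeomorph.neg ℝ ∈ G) :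
    Homeomorph.neg ℝ ∈ Subgroup.normalizer (G : Set (ℝ ≃ₜ ℝ)) := by
  rw [Subgroup.mem_normalizer_iff, neg_inv_eq]
  refine fun f => ⟨hG f, fun hf => ?_⟩
  have := hG _ hf
  rwa [mul_assoc, mul_assoc, mul_assoc, neg_mul_self, mul_one, ← mul_assoc, neg_mul_self,
    one_mul] at this

theorem mem_normalizer_A_iff_B {h : ℝ ≃ₜ ℝ} (hpl : IsPL h) :
    h ∈ Subgroup.normalizer (A n : Set (ℝ ≃ₜ ℝ)) ↔
      h ∈ Subgroup.normalizer (B n : Set (ℝ ≃ₜ ℝ)) := by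
  have hpos : ∀ g : ℝ ≃ₜ ℝ, g ∈ PLPlus → (g ∈ Subgroup.normalizer (A n : Set (ℝ ≃ₜ ℝ)) ↔
      g ∈ Subgroup.normalizer (B n : Set (ℝ ≃ₜ ℝ))) := by
    intro g hg
    have h1 := SetLike.ext_iff.1 (autPL_A.trans (autPL_B (n := n)).symm) g
    rw [AutPL, AutPL, Subgroup.mem_inf, Subgroup.mem_inf] at h1
    exact ⟨fun h => (h1.1 ⟨h, hg⟩).1, fun h => (h1.2 ⟨h, hg⟩).1⟩
  rcases h.continuous.strictMono_of_inj h.injective with hm | hm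
  · exact hpos h ⟨hm, hpl⟩
  -- Negation normalizes both groups, so composing a decreasing h with it changes neither
  -- membership.
  · have hneg : h * Homeomorph.neg ℝ ∈ PLPlus := by
      refine ⟨fun x y hxy => hm (neg_lt_neg hxy), fun x => ?_⟩
      obtain ⟨⟨a, ha⟩, b, hb⟩ := hpl (-x)
      exact ⟨⟨_, hb.comp_neg⟩, _, ha.comp_neg⟩
    have := hpos _ hneg
    rwa [Subgroup.mul_mem_cancel_right _ (neg_mem_normalizer fun _ => conj_neg_mem_A),
      Subgroup.mul_mem_cancel_right _ (neg_mem_normalizer fun _ => conj_neg_mem_B)] at this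

end PLR

theorem theorem6p1p4 (n : ℕ) [n.AtLeastTwo] :
    -- the same PL homeomorphisms (of either orientation) normalize `A_n(ℝ)` and `B_n(ℝ)`
    (∀ h : ℝ ≃ₜ ℝ, IsPL h →
      (h ∈ Subgroup.normalizer (A n : Set (ℝ ≃ₜ ℝ)) ↔
        h ∈ Subgroup.normalizer (B n : Set (ℝ ≃ₜ ℝ)))) ∧
    AutPL (A n) = AutPL (B n) ∧
    -- description of the orientation preserving PL normalizers
    (∀ h : ℝ ≃ₜ ℝ, h ∈ AutPL (A n) ↔
      StrictMono h ∧ IsPL h ∧ breaks h ⊆ ZInv n ∧ h '' (ZInv n : Set ℝ) = ZInv n ∧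
        ∃ c : SlopeQuot n, ∀ m ∈ slopes h, ∃ s : primeGrp n,
          ((s : ℝˣ) : ℝ) = m ∧ (QuotientGroup.mk s : SlopeQuot n) = c) ∧
    Nonempty (OutPL (A n) ≃* SlopeQuot n) ∧
    Nonempty (OutPL (B n) ≃* AffQuot n) := by
  refine ⟨fun h hpl => mem_normalizer_A_iff_B hpl, autPL_A.trans autPL_B.symm, fun h => ?_, ?_, ?_⟩
  · rw [autPL_A]
    constructor
    · rintro ⟨c, hc⟩
      exact ⟨hc.strictMono, hc.isPL, hc.breaks_subset, hc.image_eq, c, hc.inCoset⟩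
    · rintro ⟨h1, h2, h3, h4, c, h5⟩
      exact ⟨c, h1, h2, h5, h3, h4⟩
  · exact nonempty_outPL_mulEquiv autPL_A
      (fun c hc => eq_one_of_commute_B fun g hg => hc g (B_le_A hg))
      (slopeCoset n) slopeCoset_surjective slopeCoset_eq_one_iff
  · exact nonempty_outPL_mulEquiv autPL_B (fun c hc => eq_one_of_commute_B hc)
      (residueAction n) residueAction_surjective residueAction_eq_one_iff
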